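/- Let $R$ be an integral domain with quotient field $K=\mathrm{qf}(R)$. An overring of $R$ is a subring of $K$ containing $R$, and $R'$ denotes the integral closure of $R$ in $K$. A domain $A$ with quotient field $K$ is called valuative if for each $x\in K$ at least one of the extensions $A\subseteq A[x]$ and $A\subseteq A[x^{-1}]$ has no ring strictly between its two ends (for $x=0$ only the first is considered; it is trivial). $A$ is called a pseudo-valuation domain if for every prime ideal $P$ of $A$ and all $x,y\in K$, $xy\in P$ implies $x\in P$ or $y\in P$; its associated valuation overring is the valuation overring $V$ of $A$ such that every prime ideal of $A$ is also a prime ideal of $V$, and $A$ and $V$ are both local with the same maximal ideal. Suppose that $R$ is a maximal non pseudo-valuation subring of $K$, that is, $R\neq K$, $R$ is not a pseudo-valuation domain, but every overring of $R$ different from $R$ is a pseudo-valuation domain. Suppose also that $R$ is local, i.e. has exactly one maximal ideal. Then the following are equivalent: (i) $R$ is a maximal non valuative domain, that is, $R\neq K$, $R$ is not valuative, but every overring of $R$ different from $R$ is valuative; (ii) $R$ is not valuative, and $R$ has a unique minimal overring $S$ (an overring $S\neq R$ contained in every overring of $R$ different from $R$) such that $S$ is a valuative pseudo-valuation domain with associated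 valuation overring $R'$. -/

import Mathlib

/- Conventions.  An integral domain `A` is considered together with a model `K` of its quotient
field (`[IsFractionRing A K]`).  The overrings of `A`, that is, the rings between `A` and `K`, are
the terms of `Subalgebra A K`; the bottom element `⊥` is `A` itself (its image in `K`), the
top element `⊤` is `K`, and the proper overrings are the `T` with `⊥ < T`.  Mathlib provides
`IsFractionRing T K` for each overring `T`, so the notions below apply to overrings as well. -/

/-- `A ⊆ A[x]` has no intermediate ring: a ring `B` with `A ⊆ B ⊆ A[x]` is `A` or `A[x]`.
(The case `A = A[x]` is allowed.) -/
def HasNoIntermediateRing (A K : Type*) [CommRing A] [Field K] [Algebra A K] (x : K) : Prop :=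
  ∀ B : Subalgebra A K, B ≤ Algebra.adjoin A {x} → B = ⊥ ∨ B = Algebra.adjoin A {x}

/-- `A` is a valuative domain: for each `x` in the quotient field, `A ⊆ A[x]` or `A ⊆ A[x⁻¹]` has
no intermediate ring.  (For `x = 0` the first alternative holds.) -/
def IsValuativeDomain (A K : Type*) [CommRing A] [IsDomain A] [Field K] [Algebra A K]
    [IsFractionRing A K] : Prop :=
  ∀ x : K, HasNoIntermediateRing A K x ∨ HasNoIntermediateRing A K x⁻¹

/-- `A` is a maximal non valuative domain: a proper subring of its quotient field which is not
valuative and all of whose proper overrings are valuative. -/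
def IsMaximalNonValuativeDomain (A K : Type*) [CommRing A] [IsDomain A] [Field K] [Algebra A K]
    [IsFractionRing A K] : Prop :=
  (⊥ : Subalgebra A K) ≠ ⊤ ∧ ¬ IsValuativeDomain A K ∧
    ∀ T : Subalgebra A K, ⊥ < T → IsValuativeDomain T K

/-- `A` is a pseudo-valuation domain: for all primes `P` of `A` and all `x`, `y` in the quotient
field, `x * y ∈ P` implies `x ∈ P` or `y ∈ P`. -/
def IsPseudoValuationDomain (A K : Type*) [CommRing A] [IsDomain A] [Field K] [Algebra A K]
    [IsFractionRing A K] : Prop :=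
  ∀ P : Ideal A, P.IsPrime → ∀ x y : K, x * y ∈ algebraMap A K '' (P : Set A) →
    x ∈ algebraMap A K '' (P : Set A) ∨ y ∈ algebraMap A K '' (P : Set A)

/-- `A` is a maximal non pseudo-valuation subring of its quotient field `K`. -/
def IsMaximalNonPseudoValuationSubring (A K : Type*) [CommRing A] [IsDomain A] [Field K]
    [Algebra A K] [IsFractionRing A K] : Prop :=
  (⊥ : Subalgebra A K) ≠ ⊤ ∧ ¬ IsPseudoValuationDomain A K ∧
    ∀ T : Subalgebra A K, ⊥ < T → IsPseudoValuationDomain T K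

/-- The subring `V` of `K` is the valuation overring associated with the (pseudo-valuation) domain
`A`: it is an overring of `A` and a valuation domain, each prime ideal of `A` is also a prime ideal
of `V`, and `A` and `V` are local with the same maximal ideal (as subsets of `K`). -/
def IsAssociatedValuationOverring (A K : Type*) [CommRing A] [IsDomain A] [Field K]
    [Algebra A K] [IsFractionRing A K] (V : Subring K) : Prop :=
  (∀ a : A, algebraMap A K a ∈ V) ∧ ValuationRing V ∧
    (∀ P : Ideal A, P.IsPrime → ∃ Q : Ideal V, Q.IsPrime ∧
      algebraMap V K '' (Q : Set V) = algebraMap A K '' (P : Set A)) ∧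
    ∃ (_ : IsLocalRing A) (_ : IsLocalRing V),
      algebraMap V K '' (IsLocalRing.maximalIdeal V : Set V) =
        algebraMap A K '' (IsLocalRing.maximalIdeal A : Set A)

/-- `S` is the unique minimal overring of `A`: a proper overring contained in every proper
overring. -/
def IsUniqueMinimalOverring (A K : Type*) [CommRing A] [IsDomain A] [Field K] [Algebra A K]
    [IsFractionRing A K] (S : Subalgebra A K) : Prop :=
  ⊥ < S ∧ ∀ T : Subalgebra A K, ⊥ < T → S ≤ T

/-! Every overring of `R` is local, so each element of `K` or its inverse is integral over `R`: `R'`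
is a valuation domain, with maximal ideal `N`, say. For `T` between `R` and `R'`, being a
pseudo-valuation domain amounts to `N ⊆ T` (`IsPseudoValuationDomain.isIntegral_inv`,
`isPseudoValuationDomain_of_integralNonunits_subset`). Hence `R[N]` is the least proper integral
overring, and Nakayama (`mul_mem_bot_of_minimal`) puts it inside the nonintegral overrings too. This
gives (ii) from (i).

Conversely, an overring of `S` that is not integral contains `R'`, hence is a valuation domain. The
integral ones `T` correspond to the intermediate fields `T/N` of the algebraic extension `R'/N` of
`S/N`, and valuativity says that all simple subextensions are minimal or trivial. This property
passes from the base `S/N` to the base `T/N` by `mem_or_mem_adjoin_simple_of_minimal`. -/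

/-! ### Algebraic extensions with minimal simple subextensions -/

open IntermediateField in
/-- In an algebraic extension all of whose simple subextensions are minimal, inseparable elements
have exponent one. -/
theorem pow_expChar_mem_bot_of_not_isSeparable {k L : Type*} [Field k] [Field L] [Algebra k L]
    [Algebra.IsAlgebraic k L] (q : ℕ) [ExpChar k q]
    (H : ∀ x y : L, y ∈ k⟮x⟯ → y ∈ (⊥ : IntermediateField k L) ∨ x ∈ k⟮y⟯)
    {x : L} (hx : ¬ IsSeparable k x) : q.Prime ∧ x ^ q ∈ (⊥ : IntermediateField k L) := by
  have hint : IsIntegral k x := (Algebra.IsAlgebraic.isAlgebraic x).isIntegral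
  have hirr := minpoly.irreducible hint
  rcases ‹ExpChar k q› with _ | hq
  · exact absurd hirr.separable hx
  · refine ⟨hq, ?_⟩
    rcases Polynomial.separable_or q hirr with h | ⟨-, g, hg, hgx⟩
    · exact absurd h hx
    -- Otherwise `x ∈ k(x ^ q)`. But `x ^ q` is a root of `g`, and the minimal polynomial of `x` is
    -- `g(X ^ q)`, of degree `q` times as large.
    refine (H x (x ^ q) (pow_mem (mem_adjoin_simple_self k x) q)).resolve_right fun hmem => ?_
    have hle : k⟮x⟯ ≤ k⟮x ^ q⟯ := adjoin_simple_le_iff.2 hmem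
    have hint' : IsIntegral k (x ^ q) := hint.pow q
    have : FiniteDimensional k k⟮x ^ q⟯ := adjoin.finiteDimensional hint'
    have h1 := Submodule.finrank_mono (R := k) (M := L)
      (s := k⟮x⟯.toSubalgebra.toSubmodule) (t := k⟮x ^ q⟯.toSubalgebra.toSubmodule) hle
    have h2 : (minpoly k x).natDegree ≤ (minpoly k (x ^ q)).natDegree := by
      rw [← adjoin.finrank hint, ← adjoin.finrank hint']
      exact h1
    have hroot : Polynomial.aeval (x ^ q) g = 0 := by
      rw [← Polynomial.expand_aeval, hgx, minpoly.aeval]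
    have h3 := Polynomial.natDegree_le_of_dvd (minpoly.dvd k _ hroot) hg.ne_zero
    have h4 : (minpoly k x).natDegree = g.natDegree * q := by
      rw [← hgx, Polynomial.natDegree_expand]
    have h5 := minpoly.natDegree_pos hint
    have h6 := hq.two_le
    nlinarith

open IntermediateField in
-- Minimality only speaks of simple extensions, so two elements must be placed in a common one. If
-- both are separable, this is the primitive element theorem. If `z` is not, `x + z` works: its
-- `q`-th power yields `x ^ q`, since `z ^ q ∈ k`, and `x ^ q` generates the same field as the
-- separable `x`.
theorem exists_mem_adjoin_simple_pair {k L : Type*} [Field k] [Field L] [Algebra k L]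
    [Algebra.IsAlgebraic k L] (q : ℕ) [ExpChar k q]
    (H : ∀ x y : L, y ∈ k⟮x⟯ → y ∈ (⊥ : IntermediateField k L) ∨ x ∈ k⟮y⟯)
    {x z : L} (hx : IsSeparable k x) : ∃ w : L, x ∈ k⟮w⟯ ∧ z ∈ k⟮w⟯ := by
  by_cases hz : IsSeparable k z
  · have : Algebra.IsSeparable k k⟮x, z⟯ := isSeparable_adjoin_pair_of_isSeparable k L hx hz
    have : FiniteDimensional k k⟮x, z⟯ := by
      apply finiteDimensional_adjoin
      intro y _
      exact (Algebra.IsAlgebraic.isAlgebraic y).isIntegral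
    obtain ⟨w, hw⟩ := Field.exists_primitive_element k k⟮x, z⟯
    have key : ∀ y : k⟮x, z⟯, (y : L) ∈ k⟮(w : L)⟯ := by
      intro y
      have hy : y ∈ k⟮w⟯ := hw ▸ mem_top
      have : (y : L) ∈ k⟮w⟯.map k⟮x, z⟯.val := (mem_map _).2 ⟨y, hy, rfl⟩
      rw [adjoin_map (f := k⟮x, z⟯.val), Set.image_singleton] at this
      exact this
    exact ⟨w, key ⟨x, subset_adjoin k _ (by simp)⟩, key ⟨z, subset_adjoin k _ (by simp)⟩⟩
  · obtain ⟨hq, hzq⟩ := pow_expChar_mem_bot_of_not_isSeparable q H hz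
    refine ⟨x + z, ?_⟩
    have : ExpChar L q := expChar_of_injective_algebraMap (algebraMap k L).injective q
    have hmem : x ^ q ∈ k⟮x + z⟯ := by
      have h1 := pow_mem (mem_adjoin_simple_self k (x + z)) q
      rw [add_pow_expChar] at h1
      have h2 := sub_mem h1 ((bot_le : ⊥ ≤ k⟮x + z⟯) hzq)
      simpa using h2
    have hx' : x ∈ k⟮x + z⟯ := by
      have h1 := mem_adjoin_simple_self k x
      rw [adjoin_simple_eq_adjoin_pow_expChar_of_isSeparable k L hx q] at h1
      exact adjoin_simple_le_iff.2 hmem h1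
    exact ⟨hx', by simpa using sub_mem (mem_adjoin_simple_self k (x + z)) hx'⟩

open IntermediateField in
/-- If all simple subextensions of the algebraic extension `L / k` are minimal (or trivial), the
same holds for `L / F`, for each intermediate field `F`. -/
theorem mem_or_mem_adjoin_simple_of_minimal {k L : Type*} [Field k] [Field L] [Algebra k L]
    [Algebra.IsAlgebraic k L]
    (H : ∀ x y : L, y ∈ k⟮x⟯ → y ∈ (⊥ : IntermediateField k L) ∨ x ∈ k⟮y⟯)
    (F : IntermediateField k L) (x y : L) (hy : y ∈ F⟮x⟯) : y ∈ F ∨ x ∈ F⟮y⟯ := by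
  by_cases hxF : x ∈ F
  · exact Or.inr (F⟮y⟯.algebraMap_mem ⟨x, hxF⟩)
  have mono : ∀ z ∈ F, x ∉ k⟮z⟯ := fun z hz hx => hxF (adjoin_simple_le_iff.2 hz hx)
  -- If `k(w)` contains `x` and some `z ∈ F` outside `k`, minimality gives `w ∈ k(z) ⊆ F`, hence `x
  -- ∈ F`.
  have hclash : ∀ z ∈ F, z ∉ (⊥ : IntermediateField k L) → ∀ w, x ∈ k⟮w⟯ → z ∉ k⟮w⟯ := by
    intro z hz hz0 w hxw hzw
    rcases H w z hzw with h | h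
    · exact hz0 h
    · exact mono z hz (adjoin_simple_le_iff.2 h hxw)
  by_cases hF : F = ⊥
  · subst hF
    have hbot : ∀ u v : L, u ∈ (⊥ : IntermediateField k L)⟮v⟯ ↔ u ∈ k⟮v⟯ := by
      intro u v
      have h1 : restrictScalars k (adjoin (⊥ : IntermediateField k L) {v}) = k⟮v⟯ := by
        rw [restrictScalars_adjoin_eq_sup]; simp
      rw [← h1]; rfl
    rw [hbot] at hy ⊢
    exact H x y hy
  obtain ⟨z, hzF, hz0⟩ := SetLike.exists_of_lt (bot_lt_iff_ne_bot.2 hF)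
  obtain ⟨q, _⟩ := ExpChar.exists k
  by_cases hx : IsSeparable k x
  · obtain ⟨w, hxw, hzw⟩ := exists_mem_adjoin_simple_pair (z := z) q H hx
    exact absurd hzw (hclash z hzF hz0 w hxw)
  by_cases hyF : y ∈ F
  · exact Or.inl hyF
  right
  -- Now `x` is inseparable with `x ^ q ∈ k`. As Frobenius is injective, `x ^ q` has no `q`-th root
  -- in `F`, so `F(x)/F` has prime degree `q` and no intermediate fields.
  obtain ⟨hq, hxq⟩ := pow_expChar_mem_bot_of_not_isSeparable q H hx
  have : ExpChar L q := expChar_of_injective_algebraMap (algebraMap k L).injective q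
  have hxqF : x ^ q ∈ F := (bot_le : ⊥ ≤ F) hxq
  have hirr : Irreducible (Polynomial.X ^ q - Polynomial.C (⟨x ^ q, hxqF⟩ : F)) := by
    refine X_pow_sub_C_irreducible_of_prime hq fun b hb => hxF ?_
    have h1 : (b : L) ^ q = x ^ q := congrArg Subtype.val hb
    have h2 : (b : L) = x := frobenius_inj L q h1
    exact h2 ▸ b.2
  have hint : IsIntegral F x := (Algebra.IsAlgebraic.isAlgebraic (R := k) x).isIntegral.tower_top
  have hroot : Polynomial.aeval x (Polynomial.X ^ q - Polynomial.C (⟨x ^ q, hxqF⟩ : F)) = 0 := by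
    rw [map_sub, map_pow, Polynomial.aeval_X, Polynomial.aeval_C]
    exact sub_self (x ^ q)
  have hmin := minpoly.eq_of_irreducible_of_monic hirr (x := x) hroot
    (Polynomial.monic_X_pow_sub_C _ hq.ne_zero)
  have hfin : Module.finrank F F⟮x⟯ = q := by
    rw [adjoin.finrank hint, ← hmin, Polynomial.natDegree_X_pow_sub_C]
  have : FiniteDimensional F F⟮x⟯ := adjoin.finiteDimensional hint
  have hsimple := isSimpleOrder_of_finrank_prime F F⟮x⟯ (hfin ▸ hq)
  have hmap : F⟮(⟨y, hy⟩ : F⟮x⟯)⟯.map F⟮x⟯.val = F⟮y⟯ := by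
    rw [adjoin_map, Set.image_singleton]; rfl
  rcases hsimple.eq_bot_or_eq_top F⟮(⟨y, hy⟩ : F⟮x⟯)⟯ with h | h
  · have h1 := mem_adjoin_simple_self F (⟨y, hy⟩ : F⟮x⟯)
    rw [h, mem_bot] at h1
    obtain ⟨c, hc⟩ := h1
    have h2 : (c : L) = y := congrArg Subtype.val hc
    exact absurd (h2 ▸ c.2) hyF
  · rw [← hmap, h]
    exact (mem_map _).2 ⟨⟨x, mem_adjoin_simple_self F x⟩, mem_top, rfl⟩

/-! ### Pseudo-valuation domains, inverses and integrality -/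

section Domain

variable {A K : Type*} [CommRing A] [IsDomain A] [Field K] [Algebra A K] [IsFractionRing A K]

/-- The elementwise form is the one that transfers to residue fields. -/
theorem hasNoIntermediateRing_iff {A K : Type*} [CommRing A] [Field K] [Algebra A K] {x : K} :
    HasNoIntermediateRing A K x ↔ ∀ y ∈ Algebra.adjoin A {x},
      y ∈ (⊥ : Subalgebra A K) ∨ x ∈ Algebra.adjoin A {y} := by
  constructor
  · intro h y hy
    rcases h (Algebra.adjoin A {y}) (Algebra.adjoin_le (by simpa using hy)) with h | h
    · exact Or.inl (h ▸ Algebra.self_mem_adjoin_singleton A y)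
    · exact Or.inr (h ▸ Algebra.self_mem_adjoin_singleton A x)
  · intro h B hB
    by_cases hbot : B ≤ ⊥
    · exact Or.inl (le_bot_iff.1 hbot)
    obtain ⟨y, hyB, hy⟩ := SetLike.not_le_iff_exists.1 hbot
    right
    refine le_antisymm hB (Algebra.adjoin_le (Set.singleton_subset_iff.2 ?_))
    exact Algebra.adjoin_le (Set.singleton_subset_iff.2 hyB) ((h y (hB hyB)).resolve_left hy)

theorem hasNoIntermediateRing_of_mem_bot {A K : Type*} [CommRing A] [Field K] [Algebra A K] {x : K}
    (hx : x ∈ (⊥ : Subalgebra A K)) : HasNoIntermediateRing A K x :=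
  hasNoIntermediateRing_iff.2 fun _ hy =>
    Or.inl (Algebra.adjoin_le (Set.singleton_subset_iff.2 hx) hy)

theorem isValuativeDomain_of_mem_or_inv_mem
    (h : ∀ x : K, x ∈ (⊥ : Subalgebra A K) ∨ x⁻¹ ∈ (⊥ : Subalgebra A K)) :
    IsValuativeDomain A K := fun x =>
  (h x).imp hasNoIntermediateRing_of_mem_bot hasNoIntermediateRing_of_mem_bot

/-- Suppose `a` and `b = 1 - a` lie in maximal ideals `P` and `Q`. Then `(a / b) * b ∈ P` while `b ∉
P`, so `a / b ∈ P`; thus `a` is a multiple of `b` and lies in `Q` as well. -/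
theorem IsPseudoValuationDomain.isLocalRing (h : IsPseudoValuationDomain A K) :
    IsLocalRing A := by
  refine IsLocalRing.of_isUnit_or_isUnit_one_sub_self fun a => ?_
  by_contra! hcon
  obtain ⟨ha, hb⟩ := hcon
  obtain ⟨P, hP, haP⟩ := exists_max_ideal_of_mem_nonunits ha
  obtain ⟨Q, hQ, hbQ⟩ := exists_max_ideal_of_mem_nonunits hb
  have key : ∀ {P : Ideal A}, P.IsMaximal → ∀ {a : A}, a ∈ P → 1 - a ∉ P := fun hP a ha hb =>
    hP.ne_top ((Ideal.eq_top_iff_one _).2 (by simpa using add_mem ha hb))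
  have hbP := key hP haP
  have haQ : a ∉ Q := fun h => key hQ h hbQ
  set b := 1 - a
  have hb0 : algebraMap A K b ≠ 0 := fun h0 =>
    hbP ((IsFractionRing.injective A K (h0.trans (map_zero _).symm)) ▸ P.zero_mem)
  rcases h P hP.isPrime (algebraMap A K a / algebraMap A K b) (algebraMap A K b)
    ⟨a, haP, by field_simp⟩ with ⟨c, -, hc⟩ | ⟨c, hcP, hc⟩
  · have : a = c * b := IsFractionRing.injective A K (by rw [map_mul, hc]; field_simp)
    exact haQ (this ▸ Q.mul_mem_left c hbQ)
  · exact hbP (IsFractionRing.injective A K hc ▸ hcP)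

theorem isIntegral_inv_of_inv_mem_adjoin {A K : Type*} [CommRing A] [Field K] [Algebra A K] {x : K}
    (h : x⁻¹ ∈ Algebra.adjoin A {x}) : IsIntegral A x⁻¹ := by
  rw [Algebra.adjoin_singleton_eq_range_aeval] at h
  obtain ⟨p, hp⟩ := h
  rcases eq_or_ne x 0 with rfl | hx
  · simpa using isIntegral_zero
  -- Divide `x⁻¹ = p(x)` by `x ^ natDegree p` to get a monic equation for `x⁻¹`.
  refine ⟨Polynomial.X ^ (p.natDegree + 1) - p.reverse, ?_, ?_⟩
  · refine Polynomial.monic_X_pow_sub ((Polynomial.degree_le_of_natDegree_le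
      p.reverse_natDegree_le).trans_lt ?_)
    exact_mod_cast Nat.lt_succ_self _
  · let := invertibleOfNonzero hx
    have h1 := Polynomial.eval₂_reverse_mul_pow (algebraMap A K) x p
    have h2 : Polynomial.eval₂ (algebraMap A K) x p = x⁻¹ := hp
    rw [h2, invOf_eq_inv] at h1
    rw [Polynomial.eval₂_sub, Polynomial.eval₂_X_pow, sub_eq_zero]
    apply mul_right_cancel₀ (pow_ne_zero p.natDegree hx)
    rw [h1, pow_succ', mul_assoc, ← mul_pow, inv_mul_cancel₀ hx, one_pow, mul_one]

theorem IsIntegral.mem_adjoin_inv {A K : Type*} [CommRing A] [Field K] [Algebra A K] {x : K}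
    (h : IsIntegral A x) : x ∈ Algebra.adjoin A {x⁻¹} := by
  rcases eq_or_ne x 0 with rfl | hx
  · exact zero_mem _
  obtain ⟨p, hp, hpx⟩ := h
  let := invertibleOfNonzero hx
  have h1 := (Polynomial.eval₂_reverse_eq_zero_iff (algebraMap A K) x p).2 hpx
  rw [invOf_eq_inv, ← Polynomial.divX_mul_X_add p.reverse, Polynomial.coeff_zero_reverse,
    hp.leadingCoeff, Polynomial.eval₂_add, Polynomial.eval₂_mul, Polynomial.eval₂_X, map_one,
    Polynomial.eval₂_one] at h1
  have h2 : x = -Polynomial.aeval x⁻¹ p.reverse.divX := by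
    rw [Polynomial.aeval_def]
    linear_combination x * h1 - Polynomial.eval₂ (algebraMap A K) x⁻¹ p.reverse.divX *
      mul_inv_cancel₀ hx
  rw [Algebra.adjoin_singleton_eq_range_aeval]
  have h3 : -Polynomial.aeval x⁻¹ p.reverse.divX ∈ (Polynomial.aeval (R := A) x⁻¹).range :=
    neg_mem ⟨_, rfl⟩
  rwa [← h2] at h3

/-- In the local ring `A[x]`, `x` or `1 - x` is a unit, so `x⁻¹` or `y = (1 - x)⁻¹` is integral. In
the latter case `y` or `1 - y` is a unit of the local integral closure; these give `x` and `x⁻¹`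
respectively, as `(1 - y)⁻¹ = 1 - x⁻¹`. -/
theorem isIntegral_or_isIntegral_inv {A K : Type*} [CommRing A] [Field K] [Algebra A K]
    (h : ∀ T : Subalgebra A K, IsLocalRing T) (x : K) : IsIntegral A x ∨ IsIntegral A x⁻¹ := by
  have hunit : ∀ {T : Subalgebra A K} {y : T}, IsUnit y → (y : K)⁻¹ ∈ T := by
    rintro T _ ⟨u, rfl⟩
    have : ((u : T) : K) * ((u⁻¹ : Tˣ) : T) = 1 := by
      rw [← MulMemClass.coe_mul, Units.mul_inv]; rfl
    rw [inv_eq_of_mul_eq_one_right this]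
    exact SetLike.coe_mem _
  have := h (Algebra.adjoin A {x})
  rcases IsLocalRing.isUnit_or_isUnit_one_sub_self
    (⟨x, Algebra.self_mem_adjoin_singleton A x⟩ : Algebra.adjoin A {x}) with hu | hu
  · exact Or.inr (isIntegral_inv_of_inv_mem_adjoin (hunit hu))
  have hadj : Algebra.adjoin A {x} ≤ Algebra.adjoin A {1 - x} := by
    refine Algebra.adjoin_le (Set.singleton_subset_iff.2 ?_)
    simpa using sub_mem (one_mem (Algebra.adjoin A {1 - x}))
      (Algebra.self_mem_adjoin_singleton A (1 - x))
  have hy : IsIntegral A (1 - x)⁻¹ := isIntegral_inv_of_inv_mem_adjoin (hadj (hunit hu))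
  have h1x : 1 - x ≠ 0 := fun h0 => hu.ne_zero (Subtype.ext h0)
  have := h (integralClosure A K)
  rcases IsLocalRing.isUnit_or_isUnit_one_sub_self
    (⟨(1 - x)⁻¹, hy⟩ : integralClosure A K) with hu | hu
  · left
    have h1 : IsIntegral A ((1 - x)⁻¹)⁻¹ := hunit hu
    simpa using isIntegral_one.sub h1
  · right
    have h1 : IsIntegral A (1 - (1 - x)⁻¹)⁻¹ := hunit hu
    rcases eq_or_ne x 0 with rfl | hx
    · simpa using isIntegral_zero
    have h2 : x⁻¹ = 1 - (1 - (1 - x)⁻¹)⁻¹ := by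
      have : 1 - (1 - x)⁻¹ = - (x / (1 - x)) := by field_simp; ring
      rw [this]
      field_simp
      ring
    rw [h2]
    exact isIntegral_one.sub h1

/-- An integral element outside a pseudo-valuation domain has an integral inverse. -/
theorem IsPseudoValuationDomain.isIntegral_inv (h : IsPseudoValuationDomain A K) {x : K}
    (hx : IsIntegral A x) (hxA : x ∉ (⊥ : Subalgebra A K)) : IsIntegral A x⁻¹ := by
  have := h.isLocalRing
  set M := IsLocalRing.maximalIdeal A
  -- Descent on the degree of a monic `p` with `p(x) ∈ M`. If the constant term is in `M`, then `x *
  -- p.divX(x) ∈ M`, and `x ∉ A` forces `p.divX(x) ∈ M`. Otherwise `x * p.divX(x)` is a unit of `A`,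
  -- which inverts `x` in `A[x]`.
  have key : ∀ (d : ℕ) (p : Polynomial A), p.natDegree = d → p.Monic →
      Polynomial.aeval x p ∈ algebraMap A K '' (M : Set A) → x⁻¹ ∈ Algebra.adjoin A {x} := by
    intro d
    induction d with
    | zero =>
      rintro p hd hp ⟨m, hm, hmp⟩
      rw [hp.natDegree_eq_zero.1 hd, map_one] at hmp
      have : m = 1 := IsFractionRing.injective A K (by rw [hmp, map_one])
      exact absurd (M.eq_top_iff_one.2 (this ▸ hm)) (IsLocalRing.maximalIdeal.isMaximal A).ne_top
    | succ d ih =>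
      rintro p hd hp ⟨m, hm, hmp⟩
      have hdiv := congrArg (Polynomial.aeval x) (Polynomial.divX_mul_X_add p)
      rw [map_add, map_mul, Polynomial.aeval_X, Polynomial.aeval_C, ← hmp] at hdiv
      by_cases h0 : p.coeff 0 ∈ M
      · have hmem : x * Polynomial.aeval x p.divX ∈ algebraMap A K '' (M : Set A) :=
          ⟨m - p.coeff 0, M.sub_mem hm h0, by rw [map_sub, ← hdiv]; ring⟩
        rcases h M (IsLocalRing.maximalIdeal.isMaximal A).isPrime _ _ hmem with ⟨c, -, hc⟩ | hc
        · exact absurd ⟨c, hc⟩ hxA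
        · refine ih p.divX (by rw [Polynomial.natDegree_divX_eq_natDegree_tsub_one, hd]; rfl) ?_ hc
          rw [Polynomial.Monic, Polynomial.leadingCoeff,
            Polynomial.natDegree_divX_eq_natDegree_tsub_one, Polynomial.coeff_divX, hd]
          simpa [hd] using hp.coeff_natDegree
      · have hu : IsUnit (m - p.coeff 0) := by
          by_contra hcon
          exact h0 (by simpa using M.sub_mem hm hcon)
        obtain ⟨c, hc⟩ := hu.exists_right_inv
        have h1 : x * (algebraMap A K c * Polynomial.aeval x p.divX) = 1 := by
          rw [← map_one (algebraMap A K), ← hc, map_mul, map_sub, ← hdiv]; ring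
        rw [inv_eq_of_mul_eq_one_right h1]
        refine mul_mem (Subalgebra.algebraMap_mem _ c) ?_
        rw [Algebra.adjoin_singleton_eq_range_aeval]
        exact ⟨_, rfl⟩
  obtain ⟨p, hp, hpx⟩ := hx
  exact isIntegral_inv_of_inv_mem_adjoin
    (key _ p rfl hp ⟨0, M.zero_mem, by rw [map_zero]; exact hpx.symm⟩)

end Domain

/-! ### The nonunits of the integral closure -/

/-- The elements of `K` whose inverse is not integral over `A`, together with `0`.  If the integral
closure of `A` in `K` is a valuation domain of `K`, this is its maximal ideal. -/
def integralNonunits (A K : Type*) [CommRing A] [Field K] [Algebra A K] : Set K :=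
  {x | x = 0 ∨ ¬ IsIntegral A x⁻¹}

theorem IsIntegral.inv_mem_of_inv {A K : Type*} [CommRing A] [Field K] [Algebra A K]
    {B : Subalgebra A K} {x : K} (h : IsIntegral A x⁻¹) (hx : x ∈ B) : x⁻¹ ∈ B := by
  have := h.mem_adjoin_inv
  rw [inv_inv] at this
  exact Algebra.adjoin_le (Set.singleton_subset_iff.2 hx) this

theorem isIntegral_of_mem_integralNonunits {A K : Type*} [CommRing A] [Field K] [Algebra A K]
    (hval : ∀ x : K, IsIntegral A x ∨ IsIntegral A x⁻¹) {x : K}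
    (hx : x ∈ integralNonunits A K) : IsIntegral A x := by
  rcases hx with rfl | hx
  · exact isIntegral_zero
  · exact (hval x).resolve_right hx

theorem mul_mem_integralNonunits {A K : Type*} [CommRing A] [Field K] [Algebra A K]
    {x y : K} (hx : IsIntegral A x)
    (hy : y ∈ integralNonunits A K) : x * y ∈ integralNonunits A K := by
  rcases eq_or_ne (x * y) 0 with h0 | h0
  · exact Or.inl h0
  refine Or.inr fun h => ?_
  rcases hy with rfl | hy
  · exact h0 (mul_zero x)
  · apply hy
    have h1 := hx.mul h
    have hx0 := left_ne_zero_of_mul h0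
    rwa [mul_inv, mul_inv_cancel_left₀ hx0] at h1

theorem isUnit_integralClosure_iff {A K : Type*} [CommRing A] [Field K] [Algebra A K]
    (v : integralClosure A K) : IsUnit v ↔ (v : K) ∉ integralNonunits A K := by
  constructor
  · rintro ⟨u, rfl⟩ h
    have hmul : (((u : integralClosure A K) : K)) * ((u⁻¹ : (integralClosure A K)ˣ) :
        integralClosure A K) = 1 := by
      rw [← MulMemClass.coe_mul, Units.mul_inv]; rfl
    rcases h with h | h
    · rw [h, zero_mul] at hmul
      exact zero_ne_one hmul
    · rw [inv_eq_of_mul_eq_one_right hmul] at h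
      exact h (u⁻¹ : (integralClosure A K)ˣ).1.2
  · intro h
    simp only [integralNonunits, Set.mem_ofPred_eq, not_or, not_not] at h
    exact IsUnit.of_mul_eq_one (⟨(v : K)⁻¹, h.2⟩ : integralClosure A K)
      (Subtype.ext (mul_inv_cancel₀ h.1))

section Domain

variable {A K : Type*} [CommRing A] [Field K] [Algebra A K] [IsFractionRing A K]

theorem mem_integralNonunits_of_mem_prime {P : Ideal A} (hP : P.IsPrime) {p : A} (hp : p ∈ P) :
    algebraMap A K p ∈ integralNonunits A K := by
  by_contra h
  simp only [integralNonunits, Set.mem_ofPred_eq, not_or, not_not] at h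
  obtain ⟨c, hc⟩ := Algebra.mem_bot.1
    (h.2.inv_mem_of_inv (Subalgebra.algebraMap_mem (⊥ : Subalgebra A K) p))
  have h1 : p * c = 1 := IsFractionRing.injective A K (by
    rw [map_mul, hc, map_one, mul_inv_cancel₀ h.1])
  exact hP.ne_top ((Ideal.eq_top_iff_one _).2 (h1 ▸ P.mul_mem_right c hp))

/-- If `A` contains the nonunits of its integral closure, each prime ideal of `A` is an ideal of the
integral closure. -/
theorem mul_mem_image_prime (hN : integralNonunits A K ⊆ (⊥ : Subalgebra A K)) {P : Ideal A}
    (hP : P.IsPrime) {x y : K} (hx : IsIntegral A x) (hy : y ∈ algebraMap A K '' (P : Set A)) :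
    x * y ∈ algebraMap A K '' (P : Set A) := by
  obtain ⟨p, hp, rfl⟩ := hy
  have hpN := mem_integralNonunits_of_mem_prime (K := K) hP hp
  -- Both `q = x * p` and `r = x ^ 2 * p` lie in `A`, and `q * q = r * p ∈ P`.
  obtain ⟨q, hq⟩ := Algebra.mem_bot.1 (hN (mul_mem_integralNonunits hx hpN))
  obtain ⟨r, hr⟩ := Algebra.mem_bot.1 (hN (mul_mem_integralNonunits (hx.pow 2) hpN))
  have h1 : q * q = r * p := IsFractionRing.injective A K (by
    rw [map_mul, map_mul, hq, hr]; ring)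
  have h2 : q * q ∈ P := h1 ▸ P.mul_mem_left r hp
  exact ⟨q, (hP.mem_or_mem h2).elim id id, hq⟩

variable [IsDomain A]

/-- If both factors are nonunits, they lie in `A`, where `P` is prime. A nonzero factor with
integral inverse can be cancelled, since `P` is stable under multiplication by integral elements. -/
theorem isPseudoValuationDomain_of_integralNonunits_subset
    (hN : integralNonunits A K ⊆ (⊥ : Subalgebra A K)) : IsPseudoValuationDomain A K := by
  intro P hP x y hxy
  by_cases hx : x ∈ integralNonunits A K
  · by_cases hy : y ∈ integralNonunits A K
    · obtain ⟨a, rfl⟩ := Algebra.mem_bot.1 (hN hx)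
      obtain ⟨b, rfl⟩ := Algebra.mem_bot.1 (hN hy)
      obtain ⟨c, hc, hab⟩ := hxy
      rw [← map_mul] at hab
      have hc' := IsFractionRing.injective A K hab ▸ hc
      exact (hP.mem_or_mem hc').imp (fun h => ⟨a, h, rfl⟩) fun h => ⟨b, h, rfl⟩
    · simp only [integralNonunits, Set.mem_ofPred_eq, not_or, not_not] at hy
      left
      have := mul_mem_image_prime hN hP hy.2 hxy
      rwa [mul_comm x, inv_mul_cancel_left₀ hy.1] at this
  · simp only [integralNonunits, Set.mem_ofPred_eq, not_or, not_not] at hx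
    right
    have := mul_mem_image_prime hN hP hx.2 hxy
    rwa [inv_mul_cancel_left₀ hx.1] at this

theorem isAssociatedValuationOverring_integralClosure
    (hval : ∀ x : K, IsIntegral A x ∨ IsIntegral A x⁻¹)
    (hN : integralNonunits A K ⊆ (⊥ : Subalgebra A K)) :
    IsAssociatedValuationOverring A K (integralClosure A K).toSubring := by
  have hpvd := isPseudoValuationDomain_of_integralNonunits_subset hN
  have hloc := hpvd.isLocalRing
  have hV : ValuationRing (integralClosure A K).toSubring := by
    refine @ValuationRing.mk _ _ _ ⟨fun a b => ?_⟩
    rcases eq_or_ne b 0 with rfl | hb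
    · exact ⟨0, Or.inl (mul_zero a)⟩
    rcases eq_or_ne a 0 with rfl | ha
    · exact ⟨0, Or.inr (mul_zero b)⟩
    have ha' : (a : K) ≠ 0 := fun h => ha (Subtype.ext h)
    have hb' : (b : K) ≠ 0 := fun h => hb (Subtype.ext h)
    rcases hval (b / a : K) with h | h
    · exact ⟨⟨_, h⟩, Or.inl (Subtype.ext (mul_div_cancel₀ (b : K) ha'))⟩
    · rw [inv_div] at h
      exact ⟨⟨_, h⟩, Or.inr (Subtype.ext (mul_div_cancel₀ (a : K) hb'))⟩
  have himage : ∀ P : Ideal A, P.IsPrime → algebraMap A K '' (P : Set A) ⊆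
      (integralClosure A K).toSubring := by
    rintro P - _ ⟨p, -, rfl⟩
    exact isIntegral_algebraMap
  refine ⟨fun a => isIntegral_algebraMap, hV, fun P hP => ?_, hloc, inferInstance, ?_⟩
  · let Q : Ideal (integralClosure A K).toSubring :=
      { carrier := {v | (v : K) ∈ algebraMap A K '' (P : Set A)}
        zero_mem' := ⟨0, P.zero_mem, map_zero _⟩
        add_mem' := by
          rintro v w ⟨a, ha, hav⟩ ⟨b, hb, hbw⟩
          exact ⟨a + b, P.add_mem ha hb, by rw [map_add, hav, hbw]; rfl⟩
        smul_mem' := fun c v hv => mul_mem_image_prime hN hP c.2 hv }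
    refine ⟨Q, ⟨fun hQ => ?_, fun {v w} hvw => hpvd P hP v w hvw⟩, ?_⟩
    · obtain ⟨p, hp, hp1⟩ : ((1 : (integralClosure A K).toSubring) : K) ∈
        algebraMap A K '' (P : Set A) := (Q.eq_top_iff_one.1 hQ : (1 : _) ∈ Q)
      have : p = 1 := IsFractionRing.injective A K (by rw [hp1, map_one]; rfl)
      exact hP.ne_top (P.eq_top_iff_one.2 (this ▸ hp))
    · ext x
      constructor
      · rintro ⟨v, hv, rfl⟩
        exact hv
      · intro hx
        exact ⟨⟨x, himage P hP hx⟩, hx, rfl⟩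
  · have hmem : ∀ v : (integralClosure A K).toSubring,
        v ∈ IsLocalRing.maximalIdeal (integralClosure A K).toSubring ↔
          (v : K) ∈ integralNonunits A K := fun v => by
      rw [IsLocalRing.mem_maximalIdeal, mem_nonunits_iff, not_iff_comm]
      exact (isUnit_integralClosure_iff (A := A) (K := K) v).symm
    have hmax := (IsLocalRing.maximalIdeal.isMaximal A).isPrime
    ext x
    constructor
    · rintro ⟨v, hv, rfl⟩
      have hvN := (hmem v).1 hv
      obtain ⟨a, ha⟩ := Algebra.mem_bot.1 (hN hvN)
      refine ⟨a, ?_, ha⟩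
      intro hu
      obtain ⟨b, hb⟩ := hu.exists_right_inv
      have h1 : algebraMap A K a * algebraMap A K b = 1 := by rw [← map_mul, hb, map_one]
      rw [ha] at h1
      rcases hvN with h | h
      · have : (v : K) = 0 := h
        change (v : K) * _ = 1 at h1
        rw [this, zero_mul] at h1
        exact zero_ne_one h1
      · apply h
        have h2 : ((algebraMap (integralClosure A K).toSubring K v))⁻¹ = algebraMap A K b :=
          inv_eq_of_mul_eq_one_right h1
        change IsIntegral A ((algebraMap (integralClosure A K).toSubring K v))⁻¹
        rw [h2]
        exact isIntegral_algebraMap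
    · rintro ⟨a, ha, rfl⟩
      exact ⟨⟨algebraMap A K a, isIntegral_algebraMap⟩,
        (hmem _).2 (mem_integralNonunits_of_mem_prime hmax ha), rfl⟩

end Domain

/-! ### The least proper overring -/

section Overrings

variable {R K : Type*} [CommRing R] [Field K] [Algebra R K]

theorem isIntegral_subalgebra_iff {T : Subalgebra R K} (hT : T ≤ integralClosure R K) {x : K} :
    IsIntegral T x ↔ IsIntegral R x := by
  have : Algebra.IsIntegral R T := ⟨fun t =>
    (isIntegral_algHom_iff T.val Subtype.val_injective).1 (hT t.2)⟩
  exact ⟨isIntegral_trans x, fun h => h.tower_top⟩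

theorem integralNonunits_subalgebra {T : Subalgebra R K} (hT : T ≤ integralClosure R K) :
    integralNonunits T K = integralNonunits R K := by
  ext x
  simp only [integralNonunits, Set.mem_ofPred_eq, isIntegral_subalgebra_iff hT]

theorem mem_bot_subalgebra_iff {T : Subalgebra R K} {x : K} :
    x ∈ (⊥ : Subalgebra T K) ↔ x ∈ T := by
  rw [Algebra.mem_bot]
  exact ⟨fun ⟨t, ht⟩ => ht ▸ t.2, fun h => ⟨⟨x, h⟩, rfl⟩⟩

theorem adjoin_singleton_le_integralClosure {x : K} (hx : IsIntegral R x) :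
    Algebra.adjoin R {x} ≤ integralClosure R K :=
  Algebra.adjoin_le (Set.singleton_subset_iff.2 hx)

theorem bot_lt_adjoin_singleton {x : K} (hx : x ∉ (⊥ : Subalgebra R K)) :
    ⊥ < Algebra.adjoin R {x} :=
  bot_lt_iff_ne_bot.2 fun h => hx (h ▸ Algebra.self_mem_adjoin_singleton R x)

/-- If `S` is integral over the local domain `R` and contained in every proper integral overring
of `R`, then `S` is multiplied into `R` by the maximal ideal of `R`. -/
theorem mul_mem_bot_of_minimal [IsLocalRing R] {S : Subalgebra R K} (hS : ⊥ < S)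
    (hSint : S ≤ integralClosure R K)
    (hmin : ∀ T : Subalgebra R K, ⊥ < T → T ≤ integralClosure R K → S ≤ T) {a : R}
    (ha : a ∈ IsLocalRing.maximalIdeal R) {s : K} (hs : s ∈ S) :
    algebraMap R K a * s ∈ (⊥ : Subalgebra R K) := by
  by_contra hcon
  have hmem : algebraMap R K a * s ∈ S := mul_mem (S.algebraMap_mem a) hs
  have heq : Algebra.adjoin R {algebraMap R K a * s} = S :=
    le_antisymm (Algebra.adjoin_le (Set.singleton_subset_iff.2 hmem))
      (hmin _ (bot_lt_adjoin_singleton hcon) (adjoin_singleton_le_integralClosure (hSint hmem)))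
  have hfg : (Subalgebra.toSubmodule S).FG := by
    rw [← heq]
    exact (show IsIntegral R _ from hSint hmem).fg_adjoin_singleton
  -- A polynomial in `a * s` is its constant term plus `a` times an element of `S`. So `S ⊆ R + M S`
  -- with `S` finite over `R`, and Nakayama gives `S ⊆ R`.
  have hle : Subalgebra.toSubmodule S ≤ Subalgebra.toSubmodule (⊥ : Subalgebra R K) := by
    refine Submodule.le_of_le_smul_of_le_jacobson_bot (I := IsLocalRing.maximalIdeal R) hfg
      (IsLocalRing.maximalIdeal_le_jacobson _) ?_
    intro y hy
    have hy' : y ∈ Algebra.adjoin R {algebraMap R K a * s} := heq ▸ hy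
    rw [Algebra.adjoin_singleton_eq_range_aeval] at hy'
    obtain ⟨p, rfl⟩ := hy'
    have hp := congrArg (Polynomial.aeval (algebraMap R K a * s)) (Polynomial.divX_mul_X_add p)
    rw [map_add, map_mul, Polynomial.aeval_X, Polynomial.aeval_C, add_comm] at hp
    have hq : Polynomial.aeval (algebraMap R K a * s) p.divX ∈ S := by
      rw [← heq, Algebra.adjoin_singleton_eq_range_aeval]
      exact ⟨_, rfl⟩
    change Polynomial.aeval (algebraMap R K a * s) p ∈ _
    rw [← hp]
    refine Submodule.add_mem_sup (Subalgebra.algebraMap_mem _ _) ?_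
    have := Submodule.smul_mem_smul ha ((Subalgebra.mem_toSubmodule S).2 (mul_mem hq hs))
    rwa [mul_left_comm, ← Algebra.smul_def]
  exact not_le_of_gt hS hle

variable [IsFractionRing R K]

theorem integralNonunits_subset_of_isPseudoValuationDomain
    (hval : ∀ x : K, IsIntegral R x ∨ IsIntegral R x⁻¹) {T : Subalgebra R K}
    (hT : T ≤ integralClosure R K) (hpvd : IsPseudoValuationDomain T K) :
    integralNonunits R K ⊆ T := by
  intro x hx
  by_contra hxT
  have hint := isIntegral_of_mem_integralNonunits hval hx
  have := hpvd.isIntegral_inv ((isIntegral_subalgebra_iff hT).2 hint)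
    (fun h => hxT (mem_bot_subalgebra_iff.1 h))
  rw [isIntegral_subalgebra_iff hT] at this
  rcases hx with rfl | hx
  · exact hxT T.zero_mem
  · exact hx this

variable [IsDomain R]

theorem IsMaximalNonPseudoValuationSubring.isLocalRing_subalgebra
    (hR : IsMaximalNonPseudoValuationSubring R K) [IsLocalRing R] (T : Subalgebra R K) :
    IsLocalRing T := by
  rcases eq_or_ne T ⊥ with rfl | hT
  · exact (Algebra.botEquivOfInjective (IsFractionRing.injective R K)).symm.toRingEquiv.isLocalRing
  · exact (hR.2.2 T (bot_lt_iff_ne_bot.2 hT)).isLocalRing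

theorem IsMaximalNonPseudoValuationSubring.isUniqueMinimalOverring
    (hR : IsMaximalNonPseudoValuationSubring R K) [IsLocalRing R] :
    IsUniqueMinimalOverring R K (Algebra.adjoin R (integralNonunits R K)) := by
  have hval := isIntegral_or_isIntegral_inv (A := R) (K := K) hR.isLocalRing_subalgebra
  have hNS : integralNonunits R K ⊆ Algebra.adjoin R (integralNonunits R K) :=
    Algebra.subset_adjoin
  have hS : ⊥ < Algebra.adjoin R (integralNonunits R K) :=
    bot_lt_iff_ne_bot.2 fun h => hR.2.1
      (isPseudoValuationDomain_of_integralNonunits_subset (h ▸ hNS))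
  have hSint : Algebra.adjoin R (integralNonunits R K) ≤ integralClosure R K :=
    Algebra.adjoin_le fun x hx => isIntegral_of_mem_integralNonunits hval hx
  have hmin : ∀ T : Subalgebra R K, ⊥ < T → T ≤ integralClosure R K →
      Algebra.adjoin R (integralNonunits R K) ≤ T := fun T hT hTint => Algebra.adjoin_le
    (integralNonunits_subset_of_isPseudoValuationDomain hval hTint (hR.2.2 T hT))
  refine ⟨hS, fun T hT => ?_⟩
  by_cases hTint : T ≤ integralClosure R K
  · exact hmin T hT hTint
  obtain ⟨t, htT, ht⟩ := SetLike.not_le_iff_exists.1 hTint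
  have ht' : IsIntegral R t⁻¹ := (hval t).resolve_left ht
  have hinv : t⁻¹ ∈ Algebra.adjoin R {t} :=
    ht'.inv_mem_of_inv (Algebra.self_mem_adjoin_singleton R t)
  -- If `t⁻¹ ∈ R`, it is a nonunit of `R`, so `t⁻¹ S ⊆ R ⊆ T`, and multiplying by `t ∈ T` gives `S ⊆
  -- T`. Otherwise `R[t⁻¹]` is a proper integral overring inside `T`.
  by_cases htR : t⁻¹ ∈ (⊥ : Subalgebra R K)
  · obtain ⟨a, ha⟩ := Algebra.mem_bot.1 htR
    have hau : a ∈ IsLocalRing.maximalIdeal R := by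
      intro hu
      obtain ⟨b, hb⟩ := hu.exists_right_inv
      apply ht
      have h1 : t⁻¹ * algebraMap R K b = 1 := by rw [← ha, ← map_mul, hb, map_one]
      have h2 := inv_eq_of_mul_eq_one_right h1
      rw [inv_inv] at h2
      rw [h2]
      exact isIntegral_algebraMap
    have ht0 : t ≠ 0 := fun h => ht (h ▸ zero_mem _)
    intro s hs
    have h1 := mul_mem htT ((bot_le : ⊥ ≤ T) (mul_mem_bot_of_minimal hS hSint hmin hau hs))
    rwa [ha, mul_inv_cancel_left₀ ht0] at h1
  · exact (hmin _ (bot_lt_adjoin_singleton htR) (adjoin_singleton_le_integralClosure ht')).trans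
      ((Algebra.adjoin_le (Set.singleton_subset_iff.2 hinv)).trans
        (Algebra.adjoin_le (Set.singleton_subset_iff.2 htT)))

end Overrings

/-! ### Passage to the residue field of the integral closure -/

section Residue

variable {R K : Type*} [CommRing R] [Field K] [Algebra R K] [IsLocalRing (integralClosure R K)]

local notation "ResK" => IsLocalRing.ResidueField (integralClosure R K)

theorem residue_integralClosure_eq_zero_iff (v : integralClosure R K) :
    IsLocalRing.residue (integralClosure R K) v = 0 ↔ (v : K) ∈ integralNonunits R K := by
  rw [IsLocalRing.residue_eq_zero_iff, IsLocalRing.mem_maximalIdeal, mem_nonunits_iff,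
    not_iff_comm]
  exact (isUnit_integralClosure_iff v).symm

theorem mem_of_residue_eq {T : Subalgebra R K} (hN : integralNonunits R K ⊆ T)
    {v w : integralClosure R K} (h : IsLocalRing.residue (integralClosure R K) v =
      IsLocalRing.residue (integralClosure R K) w) (hw : (w : K) ∈ T) : (v : K) ∈ T := by
  rw [← sub_eq_zero, ← map_sub, residue_integralClosure_eq_zero_iff] at h
  simpa using add_mem (show (v : K) - w ∈ T from hN h) hw

/-- The image, in the residue field of the integral closure, of an overring that contains the
nonunits of the integral closure. -/
def residueSubfield (T : Subalgebra R K) : Subfield ResK where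
  __ := (T.toSubring.comap (integralClosure R K).toSubring.subtype).map
    (IsLocalRing.residue (integralClosure R K))
  inv_mem' := by
    rintro _ ⟨v, hv, rfl⟩
    by_cases h0 : IsLocalRing.residue (integralClosure R K) v = 0
    · exact ⟨0, T.zero_mem, by rw [h0, map_zero, inv_zero]⟩
    have hvN := mt (residue_integralClosure_eq_zero_iff v).2 h0
    simp only [integralNonunits, Set.mem_ofPred_eq, not_or, not_not] at hvN
    refine ⟨⟨(v : K)⁻¹, hvN.2⟩, hvN.2.inv_mem_of_inv (B := T) hv, ?_⟩
    apply eq_inv_of_mul_eq_one_left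
    rw [← map_mul, ← map_one (IsLocalRing.residue (integralClosure R K))]
    exact congrArg _ (Subtype.ext (inv_mul_cancel₀ hvN.1))

theorem residue_mem_residueSubfield_iff {T : Subalgebra R K} (hN : integralNonunits R K ⊆ T)
    (v : integralClosure R K) :
    IsLocalRing.residue (integralClosure R K) v ∈ residueSubfield T ↔ (v : K) ∈ T :=
  ⟨fun ⟨_, hw, hwv⟩ => mem_of_residue_eq hN hwv.symm hw, fun h => ⟨v, h, rfl⟩⟩

/-- The field `F` is kept abstract, tied to `T` only by `hF`, so as to cover both a subfield of the
residue field and an intermediate field. -/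
theorem isIntegral_residue {F : Type*} [Field F] [Algebra F ResK] {T : Subalgebra R K}
    (hF : ∀ v : integralClosure R K, IsLocalRing.residue (integralClosure R K) v ∈
      (algebraMap F ResK).range ↔ (v : K) ∈ T) (z : ResK) : IsIntegral F z := by
  obtain ⟨v, rfl⟩ := IsLocalRing.residue_surjective z
  have hv : IsIntegral R v := integralClosure.isIntegral v
  obtain ⟨p, hp, hpv⟩ := hv
  have hmem : ∀ r : R, IsLocalRing.residue (integralClosure R K)
      (algebraMap R (integralClosure R K) r) ∈ (algebraMap F ResK).range := fun r =>
    (hF _).2 (T.algebraMap_mem r)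
  let φ : R →+* (algebraMap F ResK).range :=
    ((IsLocalRing.residue (integralClosure R K)).comp
      (algebraMap R (integralClosure R K))).codRestrict _ hmem
  have h1 : IsIntegral (algebraMap F ResK).range (IsLocalRing.residue (integralClosure R K) v) := by
    refine ⟨p.map φ, hp.map φ, ?_⟩
    rw [Polynomial.eval₂_map]
    have := congrArg (IsLocalRing.residue (integralClosure R K)) hpv
    rw [Polynomial.hom_eval₂, map_zero] at this
    exact this
  let ψ : (algebraMap F ResK).range →+* F :=
    (RingEquiv.ofBijective (algebraMap F ResK).rangeRestrict
      ⟨fun a b h => (algebraMap F ResK).injective (congrArg Subtype.val h),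
        (algebraMap F ResK).rangeRestrict_surjective⟩).symm.toRingHom
  obtain ⟨q, hq, hqv⟩ := h1
  refine ⟨q.map ψ, hq.map ψ, ?_⟩
  rw [Polynomial.eval₂_map]
  convert hqv using 2
  ext c
  exact congrArg Subtype.val ((RingEquiv.ofBijective (algebraMap F ResK).rangeRestrict
      ⟨fun a b h => (algebraMap F ResK).injective (congrArg Subtype.val h),
        (algebraMap F ResK).rangeRestrict_surjective⟩).apply_symm_apply c)

open IntermediateField in
-- By algebraicity, the simple extension is the ring generated by the residue of `v`, so its
-- elements lift to `T[v]`; the choice of lift is immaterial because `N ⊆ T`.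
theorem residue_mem_adjoin_simple_iff {F : Type*} [Field F] [Algebra F ResK] {T : Subalgebra R K}
    (hT : T ≤ integralClosure R K) (hN : integralNonunits R K ⊆ T)
    (hF : ∀ v : integralClosure R K, IsLocalRing.residue (integralClosure R K) v ∈
      (algebraMap F ResK).range ↔ (v : K) ∈ T) (v w : integralClosure R K) :
    IsLocalRing.residue (integralClosure R K) w ∈
        F⟮IsLocalRing.residue (integralClosure R K) v⟯ ↔
      (w : K) ∈ Algebra.adjoin T {(v : K)} := by
  rw [← mem_toSubalgebra,
    adjoin_simple_toSubalgebra_of_isAlgebraic (isIntegral_residue hF _).isAlgebraic]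
  constructor
  · intro hw
    have key : ∀ z ∈ Algebra.adjoin F {IsLocalRing.residue (integralClosure R K) v},
        ∃ u : integralClosure R K, IsLocalRing.residue (integralClosure R K) u = z ∧
          (u : K) ∈ Algebra.adjoin T {(v : K)} := by
      intro z hz
      induction hz using Algebra.adjoin_induction with
      | mem x hx =>
        rw [Set.mem_singleton_iff] at hx
        exact ⟨v, hx.symm, Algebra.self_mem_adjoin_singleton T (v : K)⟩
      | algebraMap c =>
        obtain ⟨u, hu⟩ := IsLocalRing.residue_surjective (algebraMap F ResK c)
        exact ⟨u, hu, Subalgebra.algebraMap_mem _ (⟨u, (hF u).1 ⟨c, hu.symm⟩⟩ : T)⟩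
      | add x y _ _ hx hy =>
        obtain ⟨a, ha, ha'⟩ := hx
        obtain ⟨b, hb, hb'⟩ := hy
        exact ⟨a + b, by rw [map_add, ha, hb], add_mem ha' hb'⟩
      | mul x y _ _ hx hy =>
        obtain ⟨a, ha, ha'⟩ := hx
        obtain ⟨b, hb, hb'⟩ := hy
        exact ⟨a * b, by rw [map_mul, ha, hb], mul_mem ha' hb'⟩
    obtain ⟨u, hu, hu'⟩ := key _ hw
    exact mem_of_residue_eq (T := (Algebra.adjoin T {(v : K)}).restrictScalars R)
      (fun x hx => Subalgebra.algebraMap_mem _ (⟨x, hN hx⟩ : T)) hu.symm hu'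
  · intro hw
    have key : ∀ y ∈ Algebra.adjoin T {(v : K)}, ∃ u : integralClosure R K, (u : K) = y ∧
        IsLocalRing.residue (integralClosure R K) u ∈
          Algebra.adjoin F {IsLocalRing.residue (integralClosure R K) v} := by
      intro y hy
      induction hy using Algebra.adjoin_induction with
      | mem x hx =>
        rw [Set.mem_singleton_iff] at hx
        exact ⟨v, hx.symm, Algebra.self_mem_adjoin_singleton F _⟩
      | algebraMap t =>
        obtain ⟨c, hc⟩ := (hF ⟨t, hT t.2⟩).2 t.2
        exact ⟨⟨t, hT t.2⟩, rfl, hc ▸ Subalgebra.algebraMap_mem _ c⟩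
      | add x y _ _ hx hy =>
        obtain ⟨a, ha, ha'⟩ := hx
        obtain ⟨b, hb, hb'⟩ := hy
        exact ⟨a + b, by rw [← ha, ← hb]; rfl, by rw [map_add]; exact add_mem ha' hb'⟩
      | mul x y _ _ hx hy =>
        obtain ⟨a, ha, ha'⟩ := hx
        obtain ⟨b, hb, hb'⟩ := hy
        exact ⟨a * b, by rw [← ha, ← hb]; rfl, by rw [map_mul]; exact mul_mem ha' hb'⟩
    obtain ⟨u, hu, hu'⟩ := key _ hw
    rwa [← Subtype.ext hu]

variable [IsFractionRing R K]

open IntermediateField in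
/-- Overrings, inside the integral closure, of a valuative domain are valuative. -/
theorem IsValuativeDomain.of_le_integralClosure
    (hval : ∀ x : K, IsIntegral R x ∨ IsIntegral R x⁻¹) {S T : Subalgebra R K} (hST : S ≤ T)
    (hT : T ≤ integralClosure R K) (hN : integralNonunits R K ⊆ S)
    (hS : IsValuativeDomain S K) : IsValuativeDomain T K := by
  have hNT : integralNonunits R K ⊆ T := hN.trans hST
  have hS' := hST.trans hT
  let k : Subfield ResK := residueSubfield S
  let k' : Subfield ResK := residueSubfield T
  have hkk' : k ≤ k' := by
    rintro _ ⟨v, hv, rfl⟩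
    exact ⟨v, hST hv, rfl⟩
  let F : IntermediateField k ResK := Subfield.extendScalars hkk'
  have hk : ∀ v : integralClosure R K, IsLocalRing.residue (integralClosure R K) v ∈
      (algebraMap k ResK).range ↔ (v : K) ∈ S := fun v => by
    rw [← residue_mem_residueSubfield_iff hN]
    exact ⟨fun ⟨c, hc⟩ => hc ▸ c.2, fun h => ⟨⟨_, h⟩, rfl⟩⟩
  have hF : ∀ v : integralClosure R K, IsLocalRing.residue (integralClosure R K) v ∈
      (algebraMap F ResK).range ↔ (v : K) ∈ T := fun v => by
    rw [← residue_mem_residueSubfield_iff hNT]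
    exact ⟨fun ⟨c, hc⟩ => hc ▸ c.2, fun h => ⟨⟨_, h⟩, rfl⟩⟩
  have : Algebra.IsAlgebraic k ResK := ⟨fun z => (isIntegral_residue hk z).isAlgebraic⟩
  have hadj := residue_mem_adjoin_simple_iff hS' hN hk
  have hbot : ∀ v : integralClosure R K, IsLocalRing.residue (integralClosure R K) v ∈
      (⊥ : IntermediateField k ResK) ↔ (v : K) ∈ S := fun v => by
    rw [← hk, mem_bot]; rfl
  have H : ∀ x y : ResK, y ∈ k⟮x⟯ → y ∈ (⊥ : IntermediateField k ResK) ∨ x ∈ k⟮y⟯ := by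
    intro x y hy
    obtain ⟨v, rfl⟩ := IsLocalRing.residue_surjective x
    obtain ⟨w, rfl⟩ := IsLocalRing.residue_surjective y
    rcases hS v with h | h
    · rw [hbot, hadj, ← mem_bot_subalgebra_iff]
      exact hasNoIntermediateRing_iff.1 h _ ((hadj v w).1 hy)
    -- Valuativity may concern `v⁻¹` instead of `v`; for nonzero residues both generate the same
    -- field, so this alternative is just as good.
    · by_cases h0 : IsLocalRing.residue (integralClosure R K) v = 0
      · exact Or.inr (h0 ▸ zero_mem _)
      have hvN := mt (residue_integralClosure_eq_zero_iff v).2 h0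
      simp only [integralNonunits, Set.mem_ofPred_eq, not_or, not_not] at hvN
      let v' : integralClosure R K := ⟨(v : K)⁻¹, hvN.2⟩
      have hv' : (IsLocalRing.residue (integralClosure R K) v)⁻¹ =
          IsLocalRing.residue (integralClosure R K) v' := by
        apply inv_eq_of_mul_eq_one_right
        rw [← map_mul, ← map_one (IsLocalRing.residue (integralClosure R K))]
        exact congrArg _ (Subtype.ext (mul_inv_cancel₀ hvN.1))
      have hsub : IsLocalRing.residue (integralClosure R K) w ∈
          k⟮IsLocalRing.residue (integralClosure R K) v'⟯ := by
        refine adjoin_simple_le_iff.2 ?_ hy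
        rw [← hv']
        simpa using inv_mem (mem_adjoin_simple_self k
          (IsLocalRing.residue (integralClosure R K) v)⁻¹)
      rcases hasNoIntermediateRing_iff.1 h _ ((hadj v' w).1 hsub) with h1 | h1
      · exact Or.inl ((hbot w).2 (mem_bot_subalgebra_iff.1 h1))
      · right
        have h2 := (hadj w v').2 h1
        rw [← hv'] at h2
        simpa using inv_mem h2
  have key : ∀ v : integralClosure R K, HasNoIntermediateRing T K (v : K) := by
    intro v
    rw [hasNoIntermediateRing_iff]
    intro y hy
    have hyint : IsIntegral R y := by
      have h1 : IsIntegral T (v : K) := (isIntegral_subalgebra_iff hT).2 v.2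
      rw [← isIntegral_subalgebra_iff hT]
      exact adjoin_singleton_le_integralClosure h1 hy
    obtain ⟨w, rfl⟩ : ∃ w : integralClosure R K, (w : K) = y := ⟨⟨y, hyint⟩, rfl⟩
    have hadj' := residue_mem_adjoin_simple_iff hT hNT hF
    rw [← hadj'] at hy ⊢
    rw [mem_bot_subalgebra_iff, ← residue_mem_residueSubfield_iff hNT]
    exact mem_or_mem_adjoin_simple_of_minimal H F _ _ hy
  exact fun x => (hval x).imp (fun h => key ⟨x, h⟩) fun h => key ⟨x⁻¹, h⟩

end Residue

/-! ### Nonintegral overrings and the equivalence -/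

section Main

variable {R K : Type*} [CommRing R] [Field K] [Algebra R K] [IsFractionRing R K]

/-- An overring that contains all nonunits of the integral closure, but is not integral, contains
the integral closure. -/
theorem isValuativeDomain_of_not_le_integralClosure
    (hval : ∀ x : K, IsIntegral R x ∨ IsIntegral R x⁻¹) {T : Subalgebra R K}
    (hN : integralNonunits R K ⊆ T) (hT : ¬ T ≤ integralClosure R K) : IsValuativeDomain T K := by
  obtain ⟨t, htT, ht⟩ := SetLike.not_le_iff_exists.1 hT
  have ht0 : t ≠ 0 := fun h => ht (h ▸ zero_mem _)
  have htN : t⁻¹ ∈ integralNonunits R K := Or.inr (by rwa [inv_inv])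
  have hle : ∀ x : K, IsIntegral R x → x ∈ (⊥ : Subalgebra T K) := fun x hx => by
    rw [mem_bot_subalgebra_iff]
    -- Write `x = (x * t⁻¹) * t`, where `x * t⁻¹` is a nonunit of the integral closure and so lies
    -- in `T`.
    have := mul_mem (hN (mul_mem_integralNonunits hx htN)) htT
    rwa [inv_mul_cancel_right₀ ht0] at this
  exact isValuativeDomain_of_mem_or_inv_mem fun x => (hval x).imp (hle x) (hle _)

theorem IsAssociatedValuationOverring.integralNonunits_subset {S : Subalgebra R K}
    (hval : ∀ x : K, IsIntegral R x ∨ IsIntegral R x⁻¹)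
    (h : IsAssociatedValuationOverring S K (integralClosure R K).toSubring) :
    integralNonunits R K ⊆ S := by
  obtain ⟨-, -, -, hS, hV, hmax⟩ := h
  intro x hx
  have hxV : IsIntegral R x := isIntegral_of_mem_integralNonunits hval hx
  have hmem : (⟨x, hxV⟩ : (integralClosure R K).toSubring) ∈
      IsLocalRing.maximalIdeal (integralClosure R K).toSubring := fun hu =>
    (isUnit_integralClosure_iff (⟨x, hxV⟩ : integralClosure R K)).1 hu hx
  obtain ⟨s, -, hs⟩ := hmax ▸ Set.mem_image_of_mem
    (algebraMap (integralClosure R K).toSubring K) hmem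
  have hs' : (s : K) = x := hs
  exact hs' ▸ s.2

end Main

theorem theorem2p14 (R K : Type*) [CommRing R] [IsDomain R] [Field K] [Algebra R K]
    [IsFractionRing R K] (hR : IsMaximalNonPseudoValuationSubring R K) (hloc : IsLocalRing R) :
    IsMaximalNonValuativeDomain R K ↔
      ¬ IsValuativeDomain R K ∧
        ∃ S : Subalgebra R K, IsUniqueMinimalOverring R K S ∧
          IsValuativeDomain S K ∧ IsPseudoValuationDomain S K ∧
          IsAssociatedValuationOverring S K (integralClosure R K).toSubring := by
  have hlocal := hR.isLocalRing_subalgebra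
  have hval := isIntegral_or_isIntegral_inv (A := R) (K := K) hlocal
  constructor
  · rintro ⟨-, hnv, hover⟩
    have hmin := hR.isUniqueMinimalOverring
    refine ⟨hnv, _, hmin, hover _ hmin.1, hR.2.2 _ hmin.1, ?_⟩
    set S := Algebra.adjoin R (integralNonunits R K)
    have hSint : S ≤ integralClosure R K :=
      Algebra.adjoin_le fun x hx => isIntegral_of_mem_integralNonunits hval hx
    have heq : (integralClosure S K).toSubring = (integralClosure R K).toSubring := by
      ext x
      exact isIntegral_subalgebra_iff hSint
    rw [← heq]
    refine isAssociatedValuationOverring_integralClosure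
      (fun x => by simpa only [isIntegral_subalgebra_iff hSint] using hval x) ?_
    rw [integralNonunits_subalgebra hSint]
    exact fun x hx => mem_bot_subalgebra_iff.2 (Algebra.subset_adjoin hx)
  · rintro ⟨hnv, S, ⟨-, hmin⟩, hSv, -, hass⟩
    refine ⟨hR.1, hnv, fun T hT => ?_⟩
    have hN := hass.integralNonunits_subset hval
    have hST := hmin T hT
    by_cases hTint : T ≤ integralClosure R K
    · have := hlocal (integralClosure R K)
      exact hSv.of_le_integralClosure hval hST hTint hN
    · exact isValuativeDomain_of_not_le_integralClosure hval (hN.trans hST) hTint
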